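/- Let $k \ge 1$ be an integer. A subset $A$ of a group $G$ is called $k$-stable if there are no $a_1,\dots,a_k,b_1,\dots,b_k \in G$ such that, for all $i,j$, one has $a_i b_j \in A$ if and only if $i \le j$. There are constants $C_k > 0$ and $e_k \in \mathbb{N}$, depending only on $k$, such that the following holds. Let $G$ be a finite group, let $A \subseteq G$ be a $k$-stable set, and let $0 < \epsilon \le \tfrac12$. Then there is a subgroup $H \le G$ of index $m = [G:H]$ such that: 1. $m \le \epsilon^{-e_k}$, and moreover $m \le C_k\, \epsilon^{-N_k}$, where $N_k = k^{2^{2^{2k}}}$; 2. there is a set $D \subseteq G$ which is a union of left cosets of $H$ and satisfies $|A \mathbin{\triangle} D| < \epsilon |H|$; 3. for every $g \in G$, either $|gH \cap A| < m^{-1}\epsilon|H|$ or $|gH \setminus A| < m^{-1}\epsilon|H|$. -/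

import Mathlib

open scoped Pointwise symmDiff

/-- A subset `A` of a group `G` is `k`-stable if there are no `a₁, …, a_k, b₁, …, b_k` in `G` such
that, for all `i` and `j`, `a_i b_j ∈ A` if and only if `i ≤ j`. -/
def IsKStable {G : Type*} [Group G] (k : ℕ) (A : Set G) : Prop :=
  ¬ ∃ a b : Fin k → G, ∀ i j : Fin k, a i * b j ∈ A ↔ i ≤ j

/-- `D` is a union of left cosets `gH` of the subgroup `H` (possibly of none). -/
def IsUnionOfLeftCosets {G : Type*} [Group G] (H : Subgroup G) (D : Set G) : Prop :=
  ∃ S : Set G, D = ⋃ g ∈ S, g • (H : Set G)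

/-!
The displacement `|A \ A x⁻¹| / |G|` is a seminorm on `G`, so if it takes no values in an interval
`(r, R]` with `2 r ≤ R`, then the elements of displacement at most `R` form a subgroup `H`, and all
of them have displacement at most `r`. Such a gap occurs among any `d` well spaced scales, where
`d` bounds the heights of the binary trees in the relation `c x ∈ A` (Hodges: a tall tree contains a
long half graph): elements `y₀, …, y_{d-1}` with rapidly growing displacements would yield a tree
of height `d`, since at each step some `g` satisfies `g w ∈ A` and `g y w ∉ A` for all leaves `w`
found so far.

Representatives of distinct left cosets of `H` are pairwise separated by at least `R |G|` labels, so
splitting them repeatedly by a balanced label gives a tree; this bounds the index of `H` by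
`(2 / R) ^ d`. Finally, for each `h ∈ H` at most `r |G|` pairs `(u, u h)` go from `A` to its
complement, so `|gH ∩ A| |gH \ A| ≤ r |H| |G|`, which is small because `r` is much smaller than the
inverse of the squared index.
-/

section Ladder

variable {α β : Type*} {E : α → β → Prop}

/-- A half graph of length `n` in the relation `E`, with no condition on the diagonal. Leaving the
diagonal free lets a ladder be extended at both ends by the root of a tree. -/
def IsLadder (E : α → β → Prop) {n : ℕ} (l : Fin n → α) (c : Fin n → β) : Prop :=
  ∀ i j, i ≠ j → (E (l i) (c j) ↔ j < i)

namespace IsLadder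

variable {n : ℕ} {l : Fin n → α} {c : Fin n → β}

lemma cons (hlc : IsLadder E l c) {x : α} {b : β} (hx : ∀ j, ¬ E x (c j)) (hb : ∀ i, E (l i) b) :
    IsLadder E (Fin.cons x l : Fin (n + 1) → α) (Fin.cons b c : Fin (n + 1) → β) := by
  intro i j hij
  cases i using Fin.cases <;> cases j using Fin.cases
  · exact absurd rfl hij
  · simp [hx]
  · simp [hb]
  · simpa using hlc _ _ (by simpa using hij)

lemma snoc (hlc : IsLadder E l c) {x : α} {b : β} (hx : ∀ j, E x (c j)) (hb : ∀ i, ¬ E (l i) b) :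
    IsLadder E (Fin.snoc l x : Fin (n + 1) → α) (Fin.snoc c b : Fin (n + 1) → β) := by
  intro i j hij
  cases i using Fin.lastCases <;> cases j using Fin.lastCases
  · exact absurd rfl hij
  · simp [hx, Fin.castSucc_lt_last]
  · simp [hb, Fin.le_last]
  · simpa using hlc _ _ (by simpa using hij)

end IsLadder

/-- There is a complete binary tree of height `h` with inner nodes labelled in `C` and leaves
labelled in `X`, such that a leaf `x` lies in the first subtree below an inner node `c` if `E x c`
holds and in the second one otherwise. -/
def HasTree (E : α → β → Prop) : ℕ → Set α → Set β → Prop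
  | 0, X, _ => X.Nonempty
  | h + 1, X, C => ∃ c ∈ C, HasTree E h (X ∩ {x | E x c}) C ∧ HasTree E h (X ∩ {x | ¬ E x c}) C

namespace HasTree

variable {h : ℕ} {X Y : Set α} {C D : Set β}

lemma map {α' β' : Type*} {E' : α' → β' → Prop} {f : α → α'} {g : β → β'}
    (hE : ∀ x c, E' (f x) (g c) ↔ E x c) (hX : HasTree E h X C) :
    HasTree E' h (f '' X) (g '' C) := by
  induction h generalizing X with
  | zero => exact Set.Nonempty.image f hX
  | succ h ih =>
    obtain ⟨c, hc, h₁, h₀⟩ := hX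
    have image_inter (p : α' → Prop) : f '' (X ∩ {x | p (f x)}) = f '' X ∩ {y | p y} :=
      Set.image_inter_preimage f X {y | p y}
    simp only [← hE] at h₁ h₀
    exact ⟨g c, Set.mem_image_of_mem g hc, image_inter (E' · (g c)) ▸ ih h₁,
      image_inter (¬ E' · (g c)) ▸ ih h₀⟩

lemma mono (hXY : X ⊆ Y) (hCD : C ⊆ D) (hX : HasTree E h X C) : HasTree E h Y D := by
  induction h generalizing X Y with
  | zero => exact Set.Nonempty.mono hXY hX
  | succ h ih =>
    obtain ⟨c, hc, h₁, h₀⟩ := hX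
    exact ⟨c, hCD hc, ih (Set.inter_subset_inter_left _ hXY) h₁,
      ih (Set.inter_subset_inter_left _ hXY) h₀⟩

lemma mono_left (hXY : X ⊆ Y) (hX : HasTree E h X C) : HasTree E h Y C :=
  hX.mono hXY subset_rfl

lemma of_le {m n : ℕ} (hmn : m ≤ n) (hX : HasTree E n X C) : HasTree E m X C := by
  induction hmn with
  | refl => exact hX
  | step _ ih =>
    obtain ⟨c, -, h₁, -⟩ := hX
    exact ih (h₁.mono_left Set.inter_subset_left)

lemma nonempty (hX : HasTree E h X C) : X.Nonempty :=
  hX.of_le h.zero_le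

lemma of_union {m n : ℕ} {C₁ C₂ : Set β} (hX : HasTree E (m + n + 1) X (C₁ ∪ C₂)) :
    HasTree E (m + 1) X C₁ ∨ HasTree E (n + 1) X C₂ := by
  induction hs : m + n generalizing m n X with
  | zero =>
    obtain ⟨rfl, rfl⟩ : m = 0 ∧ n = 0 := by lia
    obtain ⟨c, hc | hc, h₁, h₀⟩ := hX
    exacts [.inl ⟨c, hc, h₁, h₀⟩, .inr ⟨c, hc, h₁, h₀⟩]
  | succ s ih =>
    rw [hs] at hX
    obtain ⟨c, hc | hc, h₁, h₀⟩ := hX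
    · cases m with
      | zero => exact .inl ⟨c, hc, h₁.nonempty, h₀.nonempty⟩
      | succ m =>
        obtain rfl : m + n = s := by lia
        rcases ih h₁ rfl with h₁ | h₁
        · exact (ih h₀ rfl).imp (⟨c, hc, h₁, ·⟩) (·.mono_left Set.inter_subset_left)
        · exact .inr (h₁.mono_left Set.inter_subset_left)
    · cases n with
      | zero => exact .inr ⟨c, hc, h₁.nonempty, h₀.nonempty⟩
      | succ n =>
        obtain rfl : m + n = s := by lia
        rcases ih h₁ rfl with h₁ | h₁
        · exact .inl (h₁.mono_left Set.inter_subset_left)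
        · exact (ih h₀ rfl).imp (·.mono_left Set.inter_subset_left) (⟨c, hc, h₁, ·⟩)

-- Fix a leaf `x` and colour each label `c` by the truth value of `E x c`; `x` and the root of a
-- monochromatic subtree extend a ladder found in one of the two halves of that subtree.
lemma exists_isLadder {n : ℕ} (hX : HasTree E (2 ^ n - 1) X C) :
    ∃ (l : Fin n → α) (c : Fin n → β), (∀ i, l i ∈ X) ∧ (∀ j, c j ∈ C) ∧ IsLadder E l c := by
  induction n generalizing X C with
  | zero => exact ⟨Fin.elim0, Fin.elim0, (·.elim0), (·.elim0), (·.elim0)⟩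
  | succ n ih =>
    obtain ⟨x, hx⟩ := hX.nonempty
    have height : 2 ^ (n + 1) - 1 = (2 ^ n - 1) + (2 ^ n - 1) + 1 := by
      have := Nat.one_le_two_pow (n := n)
      rw [pow_succ]
      lia
    have colouring : C = (C ∩ {c | E x c}) ∪ (C ∩ {c | ¬ E x c}) :=
      (Set.inter_union_compl C {c | E x c}).symm
    rw [height, colouring] at hX
    rcases hX.of_union with ⟨b, hb, -, hX⟩ | ⟨b, hb, hX, -⟩
    · obtain ⟨l, c, hl, hc, hlc⟩ := ih hX
      exact ⟨Fin.snoc l x, Fin.snoc c b, by simp [Fin.forall_fin_succ', hx, (hl _).1],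
        by simp [Fin.forall_fin_succ', hb.1, (hc _).1],
        hlc.snoc (fun j ↦ (hc j).2) (fun i ↦ (hl i).2)⟩
    · obtain ⟨l, c, hl, hc, hlc⟩ := ih hX
      exact ⟨Fin.cons x l, Fin.cons b c, by simp [Fin.forall_fin_succ, hx, (hl _).1],
        by simp [Fin.forall_fin_succ, hb.1, (hc _).1],
        hlc.cons (fun j ↦ (hc j).2) (fun i ↦ (hl i).2)⟩

end HasTree

end Ladder

section Separated

variable {α β : Type*} {E : α → β → Prop} {R : ℝ} {F : Finset α}

open Classical in
lemma sum_card_mul_card_filter_not [Fintype β] (E : α → β → Prop) (F : Finset α) :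
    ∑ c, (F.filter (E · c)).card * (F.filter (¬ E · c)).card =
      ∑ p ∈ F.offDiag, {c | E p.1 c ∧ ¬ E p.2 c}.ncard := by
  have above (c : β) : F.offDiag.bipartiteAbove (fun c p ↦ E p.1 c ∧ ¬ E p.2 c) c =
      F.filter (E · c) ×ˢ F.filter (¬ E · c) := by
    ext p
    simp only [Finset.mem_bipartiteAbove, Finset.mem_offDiag, Finset.mem_product,
      Finset.mem_filter]
    grind
  have below (p : α × α) : {c | E p.1 c ∧ ¬ E p.2 c} =
      Finset.univ.bipartiteBelow (fun c p ↦ E p.1 c ∧ ¬ E p.2 c) p := by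
    ext
    simp
  simp only [← Finset.card_product, ← above, below, Set.ncard_coe_finset]
  exact Finset.sum_card_bipartiteAbove_eq_sum_card_bipartiteBelow _

open Classical in
lemma exists_le_card_mul_card_filter_not [Finite β] [Nonempty β]
    (hF : (F : Set α).Pairwise fun x y ↦ R * Nat.card β ≤ {c | E x c ∧ ¬ E y c}.ncard) :
    ∃ c, R * (F.card * (F.card - 1)) ≤
      ((F.filter (E · c)).card * (F.filter (¬ E · c)).card : ℝ) := by
  cases nonempty_fintype β
  have pairs := Finset.card_nsmul_le_sum F.offDiag _ _ fun p hp ↦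
    hF (Finset.mem_offDiag.1 hp).1 (Finset.mem_offDiag.1 hp).2.1 (Finset.mem_offDiag.1 hp).2.2
  have double_count := congrArg (Nat.cast (R := ℝ)) (sum_card_mul_card_filter_not E F)
  push_cast at double_count
  have average : ∑ _c : β, R * (F.card * (F.card - 1)) ≤
      ∑ c, ((F.filter (E · c)).card * (F.filter (¬ E · c)).card : ℝ) := by
    rw [Finset.offDiag_card, nsmul_eq_mul, Nat.cast_sub (Nat.le_mul_self _), Nat.cast_mul,
      ← double_count] at pairs
    rw [Finset.sum_const, Finset.card_univ, nsmul_eq_mul, ← Nat.card_eq_fintype_card]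
    linarith
  obtain ⟨c, -, hc⟩ := Finset.exists_le_of_sum_le Finset.univ_nonempty average
  exact ⟨c, hc⟩

open Classical in
lemma exists_balanced_split [Finite β] [Nonempty β] (hR : 0 ≤ R)
    (hF : (F : Set α).Pairwise fun x y ↦ R * Nat.card β ≤ {c | E x c ∧ ¬ E y c}.ncard)
    (hF₂ : 2 ≤ F.card) :
    ∃ c, R / 2 * F.card ≤ (F.filter (E · c)).card ∧
      R / 2 * F.card ≤ (F.filter (¬ E · c)).card := by
  obtain ⟨c, hc⟩ := exists_le_card_mul_card_filter_not hF
  have hcard : (2 : ℝ) ≤ F.card := by exact_mod_cast hF₂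
  have large (u v : ℕ) (huv : u + v = F.card)
      (h : R * (F.card * (F.card - 1)) ≤ (u * v : ℝ)) : R / 2 * F.card ≤ u := by
    have hv : (v : ℝ) ≤ F.card := by exact_mod_cast huv ▸ Nat.le_add_left v u
    refine le_of_mul_le_mul_right ?_ (two_pos.trans_le hcard)
    calc R / 2 * F.card * F.card ≤ R * (F.card * (F.card - 1)) := by
          nlinarith [mul_nonneg hR (mul_nonneg (Nat.cast_nonneg' F.card) (sub_nonneg.2 hcard))]
      _ ≤ u * v := h
      _ ≤ u * F.card := by gcongr
  have hsum := F.card_filter_add_card_filter_not (E · c)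
  refine ⟨c, large _ _ hsum hc, large _ _ ((add_comm _ _).trans hsum) ?_⟩
  rwa [mul_comm ((F.filter (¬ E · c)).card : ℝ)]

lemma HasTree.of_pairwise_separated [Finite β] [Nonempty β] (hR : 0 < R) (hR₁ : R ≤ 1) {h : ℕ}
    (hF : (F : Set α).Pairwise fun x y ↦ R * Nat.card β ≤ {c | E x c ∧ ¬ E y c}.ncard)
    (hcard : (2 / R) ^ h ≤ F.card) : HasTree E h (F : Set α) Set.univ := by
  classical
  induction h generalizing F with
  | zero =>
    rw [pow_zero, Nat.one_le_cast] at hcard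
    exact Finset.card_pos.1 hcard
  | succ h ih =>
    have hbase : 2 ≤ 2 / R := le_div_self zero_le_two hR hR₁
    have hF₂ : (2 : ℝ) ≤ F.card :=
      hbase.trans <| (le_self_pow₀ (one_le_two.trans hbase) h.succ_ne_zero).trans hcard
    have hhalf : (2 / R) ^ h ≤ R / 2 * F.card := by
      calc (2 / R) ^ h = R / 2 * (2 / R) ^ (h + 1) := by rw [pow_succ]; field_simp
        _ ≤ R / 2 * F.card := by gcongr
    obtain ⟨c, h₁, h₀⟩ := exists_balanced_split hR.le hF (by exact_mod_cast hF₂)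
    refine ⟨c, Set.mem_univ c, ?_, ?_⟩
    · simpa [Set.inter_def] using ih (hF.mono (Finset.filter_subset _ F)) (hhalf.trans h₁)
    · simpa [Set.inter_def] using ih (hF.mono (Finset.filter_subset _ F)) (hhalf.trans h₀)

end Separated

section Displacement

variable {G : Type*} [Group G]

/-- The right factors `x` as leaves and the left factors `c` as labels: a `k`-stable set is one for
which this relation contains no half graph of length `k`. -/
def MulMem (A : Set G) (x c : G) : Prop :=
  c * x ∈ A

lemma IsKStable.not_hasTree {k : ℕ} {A : Set G} (hA : IsKStable k A) :
    ¬ HasTree (MulMem A) (2 ^ (2 * k) - 1) Set.univ Set.univ := by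
  intro hX
  obtain ⟨l, c, -, -, hlc⟩ := hX.exists_isLadder
  -- Even labels and odd leaves avoid the uncontrolled diagonal of the ladder.
  refine hA ⟨fun i ↦ c ⟨2 * i, by lia⟩, fun j ↦ l ⟨2 * j + 1, by lia⟩, fun i j ↦ ?_⟩
  refine (hlc _ _ (by simp only [ne_eq, Fin.mk.injEq]; lia)).trans ?_
  rw [Fin.mk_lt_mk, Fin.le_def]
  lia

lemma HasTree.smul {A : Set G} {n : ℕ} {X : Set G} (hX : HasTree (MulMem A) n X Set.univ) (v : G) :
    HasTree (MulMem A) n (v • X) Set.univ :=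
  (hX.map (f := (v * ·)) (g := (· * v⁻¹)) fun x c ↦ by simp [MulMem, mul_assoc]).mono
    subset_rfl (Set.subset_univ _)

/-- The elements of `A` that right multiplication by `x` moves out of `A`. -/
def exitSet (A : Set G) (x : G) : Set G :=
  {g | g ∈ A ∧ g * x ∉ A}

lemma ncard_preimage_mul_right (S : Set G) (x : G) : ((· * x) ⁻¹' S).ncard = S.ncard :=
  congrArg ENat.toNat (Set.encard_preimage_of_bijective (Group.mulRight_bijective x) S)

variable [Finite G]

lemma ncard_exitSet_inv (A : Set G) (x : G) : (exitSet A x⁻¹).ncard = (exitSet A x).ncard := by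
  have translate : (· * x) ⁻¹' exitSet A x⁻¹ = (· * x) ⁻¹' A \ A := by
    ext g
    simp [exitSet]
  rw [← ncard_preimage_mul_right _ x, translate]
  exact ((Set.ncard_eq_ncard_iff_ncard_sdiff_eq_ncard_sdiff).1 (ncard_preimage_mul_right A x))

lemma ncard_exitSet_mul_le (A : Set G) (x y : G) :
    (exitSet A (x * y)).ncard ≤ (exitSet A x).ncard + (exitSet A y).ncard := by
  rw [← ncard_preimage_mul_right (exitSet A y) x]
  refine (Set.ncard_le_ncard fun g hg ↦ ?_).trans (Set.ncard_union_le _ _)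
  by_cases hgx : g * x ∈ A
  · exact .inr ⟨hgx, by simpa [mul_assoc] using hg.2⟩
  · exact .inl ⟨hg.1, hgx⟩

/-- The proportion of elements of `G` that lie in `A` and leave it under right multiplication by
`x`, that is, `|A \ A x⁻¹| / |G|`; it measures how far `x` is from stabilizing `A`. -/
noncomputable def displacement (A : Set G) : GroupSeminorm G where
  toFun x := (exitSet A x).ncard / Nat.card G
  map_one' := by simp [exitSet]
  mul_le' x y := by
    rw [← add_div]
    gcongr
    exact_mod_cast ncard_exitSet_mul_le A x y
  inv' x := by rw [ncard_exitSet_inv]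

lemma ncard_exitSet (A : Set G) (x : G) :
    ((exitSet A x).ncard : ℝ) = displacement A x * Nat.card G :=
  (div_mul_cancel₀ _ (Nat.cast_ne_zero.2 Nat.card_pos.ne')).symm

end Displacement

section Gap

variable {G : Type*} [Group G]

/-- If a seminorm takes no values in the interval `(r, R]` and `2 * r ≤ R`, then the elements of
seminorm at most `R` form a subgroup. -/
def subgroupOfGap (f : GroupSeminorm G) {r R : ℝ} (hR : 0 ≤ R) (hrR : 2 * r ≤ R)
    (hgap : ∀ x, f x ≤ R → f x ≤ r) : Subgroup G where
  carrier := {x | f x ≤ R}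
  mul_mem' {x y} hx hy := (map_mul_le_add f x y).trans (by linarith [hgap x hx, hgap y hy])
  one_mem' := by simpa using hR
  inv_mem' {x} hx := by simpa using hx

lemma ncard_biUnion_le_mul {ι α : Type*} {s : Set ι} (hs : s.Finite) {f : ι → Set α} {r : ℝ}
    (hf : ∀ i ∈ s, (f i).ncard ≤ r) : (⋃ i ∈ s, f i).ncard ≤ s.ncard * r := by
  have hsum : ((⋃ i ∈ s, f i).ncard : ℝ) ≤ ∑ i ∈ hs.toFinset, ((f i).ncard : ℝ) := by
    have := hs.toFinset.set_ncard_biUnion_le f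
    simp only [Set.Finite.mem_toFinset] at this
    exact_mod_cast this
  refine hsum.trans ((Finset.sum_le_card_nsmul _ _ r (by simpa using hf)).trans_eq ?_)
  rw [nsmul_eq_mul, Set.ncard_eq_toFinset_card s hs]

variable [Finite G] {A : Set G}

lemma exists_forall_mul_mem_and_mul_mul_notMem {W : Set G} {s : ℝ}
    (hs : ∀ w ∈ W, displacement A w ≤ s) {y : G} (hy : 2 * W.ncard * s < displacement A y) :
    ∃ g, ∀ w ∈ W, g * w ∈ A ∧ g * (y * w) ∉ A := by
  by_contra! hcon
  let bad (w : G) : Set G := exitSet A w ∪ (· * (y * w)) ⁻¹' exitSet A w⁻¹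
  have hcover : exitSet A y ⊆ ⋃ w ∈ W, bad w := by
    intro g ⟨hg, hgy⟩
    obtain ⟨w, hw, hgw⟩ := hcon g
    refine Set.mem_biUnion hw ?_
    by_cases h : g * w ∈ A
    · exact .inr ⟨hgw h, by simpa [mul_assoc] using hgy⟩
    · exact .inl ⟨hg, h⟩
  have hbad : ∀ w ∈ W, ((bad w).ncard : ℝ) ≤ 2 * s * Nat.card G := by
    intro w hw
    calc ((bad w).ncard : ℝ) ≤ (exitSet A w).ncard + (exitSet A w).ncard := by
          rw [← Nat.cast_add]
          gcongr
          refine (Set.ncard_union_le _ _).trans_eq ?_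
          rw [ncard_preimage_mul_right, ncard_exitSet_inv]
      _ = 2 * displacement A w * Nat.card G := by rw [ncard_exitSet]; ring
      _ ≤ 2 * s * Nat.card G := by gcongr; exact hs w hw
  have : displacement A y * Nat.card G ≤ 2 * W.ncard * s * Nat.card G := by
    calc displacement A y * Nat.card G = (exitSet A y).ncard := (ncard_exitSet A y).symm
      _ ≤ (⋃ w ∈ W, bad w).ncard := by gcongr; exact Set.toFinite _
      _ ≤ W.ncard * (2 * s * Nat.card G) := ncard_biUnion_le_mul W.toFinite hbad
      _ = 2 * W.ncard * s * Nat.card G := by ring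
  exact hy.not_ge (le_of_mul_le_mul_right this (Nat.cast_pos.2 Nat.card_pos))

lemma HasTree.union_smul {n : ℕ} {W : Set G} (hW : HasTree (MulMem A) n W Set.univ) {s : ℝ}
    (hs : ∀ w ∈ W, displacement A w ≤ s) {y : G} (hy : 2 * W.ncard * s < displacement A y) :
    HasTree (MulMem A) (n + 1) (W ∪ y • W) Set.univ := by
  obtain ⟨g, hg⟩ := exists_forall_mul_mem_and_mul_mul_notMem hs hy
  refine ⟨g, Set.mem_univ g, hW.mono_left fun w hw ↦ ⟨.inl hw, (hg w hw).1⟩,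
    (hW.smul y).mono_left ?_⟩
  rintro _ ⟨w, hw, rfl⟩
  exact ⟨.inr (Set.smul_mem_smul_set hw), (hg w hw).2⟩

lemma exists_displacement_gap {d : ℕ} (hA : ¬ HasTree (MulMem A) d Set.univ Set.univ) {r : ℕ → ℝ}
    (hr₀ : 0 ≤ r 0) (hr : ∀ i < d, 2 * r i ≤ r (i + 1)) :
    ∃ i < d, ∀ x, displacement A x ≤ r (i + 1) → displacement A x ≤ 2 ^ (d + 2) * r i := by
  by_contra! hcon
  have tree : ∀ n ≤ d, 0 ≤ r n ∧ ∃ W : Set G, W.ncard ≤ 2 ^ n ∧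
      (∀ w ∈ W, displacement A w ≤ 2 * r n) ∧ HasTree (MulMem A) n W Set.univ := by
    intro n
    induction n with
    | zero => exact fun _ ↦ ⟨hr₀, {1}, by simp, by simpa using hr₀, Set.singleton_nonempty 1⟩
    | succ n ih =>
      intro hn
      obtain ⟨hrn, W, hcard, hW, htree⟩ := ih (by lia)
      obtain ⟨y, hyr, hy⟩ := hcon n hn
      have hstep := hr n hn
      refine ⟨by linarith, W ∪ y • W, ?_, ?_, htree.union_smul hW (lt_of_le_of_lt ?_ hy)⟩
      · grind [Set.ncard_union_le W (y • W), Set.ncard_smul_set y W]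
      · rintro _ (hw | ⟨w, hw, rfl⟩)
        · linarith [hW _ hw]
        · exact (map_mul_le_add _ y w).trans (by linarith [hW w hw])
      · calc 2 * (W.ncard : ℝ) * (2 * r n) ≤ 2 * 2 ^ d * (2 * r n) := by
              gcongr
              exact_mod_cast hcard.trans (Nat.pow_le_pow_right two_pos (by lia))
          _ = 2 ^ (d + 2) * r n := by ring
  obtain ⟨-, W, -, -, htree⟩ := tree d le_rfl
  exact hA (htree.mono_left (Set.subset_univ W))

end Gap

section Cosets

variable {G : Type*} [Group G] [Finite G] {A : Set G} {H : Subgroup G}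

lemma index_lt_of_forall_le_displacement {R : ℝ} (hR : 0 < R) (hR₁ : R ≤ 1)
    (hH : ∀ x ∉ H, R ≤ displacement A x) {d : ℕ}
    (hA : ¬ HasTree (MulMem A) d Set.univ Set.univ) : (H.index : ℝ) < (2 / R) ^ d := by
  classical
  cases nonempty_fintype (G ⧸ H)
  by_contra! hcon
  let F : Finset G := Finset.univ.image (Quotient.out : G ⧸ H → G)
  have hF : F.card = H.index := by
    rw [Finset.card_image_of_injective _ Quotient.out_injective, Finset.card_univ,
      ← Nat.card_eq_fintype_card]
    rfl
  have hsep : (F : Set G).Pairwise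
      fun x y ↦ R * Nat.card G ≤ {c | MulMem A x c ∧ ¬ MulMem A y c}.ncard := by
    simp only [F, Finset.coe_image, Finset.coe_univ, Set.image_univ]
    rintro _ ⟨p, rfl⟩ _ ⟨q, rfl⟩ hpq
    have hnotMem : p.out⁻¹ * q.out ∉ H := by
      rw [← QuotientGroup.eq, QuotientGroup.out_eq', QuotientGroup.out_eq']
      exact fun h ↦ hpq (congrArg _ h)
    have translate : {c | MulMem A p.out c ∧ ¬ MulMem A q.out c} =
        (· * p.out) ⁻¹' exitSet A (p.out⁻¹ * q.out) := by
      ext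
      simp [MulMem, exitSet, mul_assoc]
    rw [translate, ncard_preimage_mul_right, ncard_exitSet]
    gcongr
    exact hH _ hnotMem
  exact hA ((HasTree.of_pairwise_separated hR hR₁ hsep (hF ▸ hcon)).mono_left (Set.subset_univ _))

/-- Every left coset of `H` is contained in `A` or disjoint from `A` up to fewer than `δ`
elements. -/
def IsAlmostHomogeneous (A : Set G) (H : Subgroup G) (δ : ℝ) : Prop :=
  ∀ g : G, ((g • (H : Set G) ∩ A).ncard : ℝ) < δ ∨ ((g • (H : Set G) \ A).ncard : ℝ) < δ

lemma ncard_inter_mul_ncard_sdiff_le {r : ℝ} (hH : ∀ h ∈ H, displacement A h ≤ r) (g : G) :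
    ((g • (H : Set G) ∩ A).ncard : ℝ) * (g • (H : Set G) \ A).ncard ≤
      Nat.card H * (r * Nat.card G) := by
  let pairs (h : G) : Set (G × G) := (fun u ↦ (u, u * h)) '' exitSet A h
  have hcover : (g • (H : Set G) ∩ A) ×ˢ (g • (H : Set G) \ A) ⊆ ⋃ h ∈ (H : Set G), pairs h := by
    rintro ⟨u, v⟩ ⟨⟨hu, huA⟩, hv, hvA⟩
    rw [mem_leftCoset_iff] at hu hv
    have huv : u⁻¹ * v ∈ H := by simpa [mul_assoc] using H.mul_mem (H.inv_mem hu) hv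
    exact Set.mem_biUnion huv ⟨u, ⟨huA, by simpa using hvA⟩, by simp⟩
  have hpairs : ∀ h ∈ (H : Set G), ((pairs h).ncard : ℝ) ≤ r * Nat.card G := by
    intro h hh
    calc ((pairs h).ncard : ℝ) ≤ (exitSet A h).ncard := by
          exact_mod_cast Set.ncard_image_le (Set.toFinite _)
      _ = displacement A h * Nat.card G := ncard_exitSet A h
      _ ≤ r * Nat.card G := by gcongr; exact hH h hh
  rw [← Nat.cast_mul, ← Set.ncard_prod]
  calc (((g • (H : Set G) ∩ A) ×ˢ (g • (H : Set G) \ A)).ncard : ℝ)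
      ≤ (⋃ h ∈ (H : Set G), pairs h).ncard := by gcongr; exact Set.toFinite _
    _ ≤ Nat.card H * (r * Nat.card G) := ncard_biUnion_le_mul (Set.toFinite _) hpairs

lemma isAlmostHomogeneous_of_displacement_le {r ε : ℝ} (hε : 0 ≤ ε)
    (hH : ∀ h ∈ H, displacement A h ≤ r) (hr : 2 * r * (H.index : ℝ) ^ 2 < ε) :
    IsAlmostHomogeneous A H (ε * Nat.card H / H.index) := by
  intro g
  by_contra! hcon
  obtain ⟨hinter, hsdiff⟩ := hcon
  have hprod := ncard_inter_mul_ncard_sdiff_le hH g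
  have hsum : ((g • (H : Set G) ∩ A).ncard : ℝ) + (g • (H : Set G) \ A).ncard = Nat.card H := by
    rw [← Nat.cast_add, Set.ncard_inter_add_ncard_sdiff_eq_ncard, Set.ncard_smul_set]
    rfl
  have hn : (0 : ℝ) < Nat.card H := Nat.cast_pos.2 Nat.card_pos
  have hm : (0 : ℝ) < H.index := Nat.cast_pos.2 (Nat.pos_of_ne_zero H.index_ne_zero_of_finite)
  rw [← H.card_mul_index, Nat.cast_mul] at hprod
  set a := ((g • (H : Set G) ∩ A).ncard : ℝ)
  set b := ((g • (H : Set G) \ A).ncard : ℝ)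
  set n := (Nat.card H : ℝ)
  set m := (H.index : ℝ)
  have hδ : 0 ≤ ε * n / m := by positivity
  -- One of `a` and `b` is at least `n / 2`, and the other one is at least `ε * n / m`.
  have hab : ε * n / m * n ≤ 2 * (a * b) := by
    rcases le_total a b with _ | _ <;> nlinarith
  have : ε * (n ^ 2 / m) ≤ 2 * r * m ^ 2 * (n ^ 2 / m) := by
    calc ε * (n ^ 2 / m) = ε * n / m * n := by ring
      _ ≤ 2 * (n * (r * (n * m))) := by linarith
      _ = 2 * r * m ^ 2 * (n ^ 2 / m) := by field_simp
  exact hr.not_ge (le_of_mul_le_mul_right this (by positivity))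

lemma ncard_lt_index_mul {X : Set G} {δ : ℝ}
    (hX : ∀ g : G, ((X ∩ g • (H : Set G)).ncard : ℝ) < δ) : (X.ncard : ℝ) < H.index * δ := by
  cases nonempty_fintype (G ⧸ H)
  have hcover : X ⊆ ⋃ q : G ⧸ H, X ∩ q.out • (H : Set G) := fun x hx ↦
    Set.mem_iUnion.2 ⟨x, hx, by
      rw [mem_leftCoset_iff, SetLike.mem_coe, ← QuotientGroup.eq, QuotientGroup.out_eq']⟩
  calc (X.ncard : ℝ) ≤ ∑ q : G ⧸ H, ((X ∩ q.out • (H : Set G)).ncard : ℝ) := by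
        exact_mod_cast (Set.ncard_le_ncard hcover).trans (Set.ncard_iUnion_le_of_fintype _)
    _ < ∑ _q : G ⧸ H, δ := Finset.sum_lt_sum_of_nonempty Finset.univ_nonempty fun q _ ↦ hX q.out
    _ = H.index * δ := by simp [Subgroup.index]

lemma IsAlmostHomogeneous.exists_isUnionOfLeftCosets {δ : ℝ} (hA : IsAlmostHomogeneous A H δ) :
    ∃ D : Set G, IsUnionOfLeftCosets H D ∧ ((A ∆ D).ncard : ℝ) < H.index * δ := by
  let S : Set G := {g | ((g • (H : Set G) \ A).ncard : ℝ) < δ}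
  have coset_eq {g x : G} (hx : x ∈ g • (H : Set G)) : x • (H : Set G) = g • (H : Set G) :=
    ((leftCoset_eq_iff H).2 (by rwa [mem_leftCoset_iff] at hx)).symm
  have mem_iff {g x : G} (hx : x ∈ g • (H : Set G)) : x ∈ ⋃ y ∈ S, y • (H : Set G) ↔ g ∈ S := by
    refine ⟨fun h ↦ ?_, fun hg ↦ Set.mem_biUnion hg hx⟩
    obtain ⟨y, hy, hxy⟩ := Set.mem_iUnion₂.1 h
    simpa only [S, Set.mem_ofPred_eq, ← coset_eq hx, coset_eq hxy] using hy
  refine ⟨⋃ y ∈ S, y • (H : Set G), ⟨S, rfl⟩, ncard_lt_index_mul fun g ↦ ?_⟩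
  by_cases hg : g ∈ S
  · refine lt_of_le_of_lt (Nat.cast_le.2 (Set.ncard_le_ncard ?_)) hg
    rintro x ⟨hx | hx, hxg⟩
    · exact absurd ((mem_iff hxg).2 hg) hx.2
    · exact ⟨hxg, hx.2⟩
  · refine lt_of_le_of_lt (Nat.cast_le.2 (Set.ncard_le_ncard ?_)) ((hA g).resolve_right hg)
    rintro x ⟨hx | hx, hxg⟩
    · exact ⟨hxg, hx.1⟩
    · exact absurd ((mem_iff hxg).1 hx.1) hg

end Cosets

section Regularity

variable {G : Type*} [Group G] [Finite G] {A : Set G} {d : ℕ} {ε : ℝ}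

lemma exists_isAlmostHomogeneous_of_gap (hA : ¬ HasTree (MulMem A) d Set.univ Set.univ)
    (hε₁ : ε ≤ 1) {ρ : ℝ} (hρ : 0 < ρ) (hρε : 2 ^ (3 * d + 3) * ρ ≤ ε)
    (hgap : ∀ x, displacement A x ≤ ρ → displacement A x ≤ 2 ^ (d + 2) * ρ ^ (2 * d + 1)) :
    ∃ H : Subgroup G, (H.index : ℝ) < (2 / ρ) ^ d ∧
      IsAlmostHomogeneous A H (ε * Nat.card H / H.index) := by
  have hd : d ≠ 0 := by
    rintro rfl
    exact hA Set.univ_nonempty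
  have hρ₁ : ρ ≤ 1 := by
    calc ρ ≤ 2 ^ (3 * d + 3) * ρ := le_mul_of_one_le_left hρ.le (one_le_pow₀ one_le_two)
      _ ≤ 1 := hρε.trans hε₁
  have hdouble : 2 * (2 ^ (d + 2) * ρ ^ (2 * d + 1)) ≤ ρ := by
    calc 2 * (2 ^ (d + 2) * ρ ^ (2 * d + 1)) = 2 ^ (d + 3) * ρ ^ (2 * d) * ρ := by ring
      _ ≤ 2 ^ (3 * d + 3) * ρ * ρ := by
          gcongr
          · exact one_le_two
          · lia
          · exact pow_le_of_le_one hρ.le hρ₁ (by lia)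
      _ ≤ 1 * ρ := by gcongr; exact hρε.trans hε₁
      _ = ρ := one_mul ρ
  let H := subgroupOfGap (displacement A) hρ.le hdouble hgap
  have hindex : (H.index : ℝ) < (2 / ρ) ^ d :=
    index_lt_of_forall_le_displacement hρ hρ₁ (fun x hx ↦ (not_le.1 hx).le) hA
  refine ⟨H, hindex, isAlmostHomogeneous_of_displacement_le (hρε.trans' (by positivity)) hgap ?_⟩
  calc 2 * (2 ^ (d + 2) * ρ ^ (2 * d + 1)) * (H.index : ℝ) ^ 2
      < 2 * (2 ^ (d + 2) * ρ ^ (2 * d + 1)) * ((2 / ρ) ^ d) ^ 2 := by gcongr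
    _ = 2 ^ (3 * d + 3) * ρ := by rw [← pow_mul, div_pow]; field_simp; ring
    _ ≤ ε := hρε

lemma exists_index_le_and_isAlmostHomogeneous (hA : ¬ HasTree (MulMem A) d Set.univ Set.univ)
    (hε : 0 < ε) (hε₁ : ε ≤ 1) :
    ∃ H : Subgroup G,
      (H.index : ℝ) ≤ 2 ^ d * (2 ^ (3 * d + 3) * ε⁻¹) ^ ((2 * d + 1) ^ d * d) ∧
      IsAlmostHomogeneous A H (ε * Nat.card H / H.index) := by
  set K : ℝ := 2 ^ (3 * d + 3) with hK
  have hK₀ : 0 < K := by positivity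
  have hK₁ : 2 ≤ K := le_self_pow₀ one_le_two (by lia)
  set t : ℝ := ε / K with ht
  have ht₀ : 0 < t := by positivity
  have ht_half : 2 * t ≤ 1 := by
    rw [ht, ← mul_div_assoc, div_le_one hK₀]
    linarith
  have ht₁ : t ≤ 1 := by linarith
  let r (i : ℕ) : ℝ := t ^ (2 * d + 1) ^ (d - i)
  have hr₀ (i : ℕ) : 0 < r i := by positivity
  have hrt (i : ℕ) : r i ≤ t := pow_le_of_le_one ht₀.le ht₁ (by positivity)
  have hr_succ (i : ℕ) (hi : i < d) : r i = r (i + 1) ^ (2 * d + 1) := by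
    simp only [r]
    rw [← pow_mul, ← pow_succ]
    congr 2
    lia
  have hr_double (i : ℕ) (hi : i < d) : 2 * r i ≤ r (i + 1) := by
    have h2d : r (i + 1) ^ (2 * d) ≤ t :=
      (pow_le_of_le_one (hr₀ _).le ((hrt _).trans ht₁) (by lia)).trans (hrt _)
    calc 2 * r i = 2 * r (i + 1) ^ (2 * d) * r (i + 1) := by rw [hr_succ i hi]; ring
      _ ≤ 2 * t * r (i + 1) := by gcongr
      _ ≤ r (i + 1) := mul_le_of_le_one_left (hr₀ _).le ht_half
  obtain ⟨i, hi, hgap⟩ := exists_displacement_gap hA (hr₀ 0).le hr_double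
  rw [hr_succ i hi] at hgap
  obtain ⟨H, hindex, hH⟩ := exists_isAlmostHomogeneous_of_gap hA hε₁ (hr₀ (i + 1))
    (by rw [← hK, ← mul_div_cancel₀ ε hK₀.ne']; gcongr; exact hrt _) hgap
  refine ⟨H, hindex.le.trans ?_, hH⟩
  have ht_inv : K * ε⁻¹ = t⁻¹ := by rw [ht, inv_div, div_eq_mul_inv]
  calc (2 / r (i + 1)) ^ d = 2 ^ d * t⁻¹ ^ ((2 * d + 1) ^ (d - (i + 1)) * d) := by
        rw [div_eq_mul_inv, mul_pow, pow_mul, inv_pow t]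
    _ ≤ 2 ^ d * (K * ε⁻¹) ^ ((2 * d + 1) ^ d * d) := by
        rw [ht_inv]
        gcongr
        · exact (one_le_inv₀ ht₀).2 ht₁
        · lia
        · lia

end Regularity

lemma two_mul_add_one_pow_mul_le_two_pow_two_pow {d : ℕ} (hd : 5 ≤ d) :
    (2 * d + 1) ^ d * d ≤ 2 ^ 2 ^ d := by
  have hexp : d * (d + 1) ≤ 2 ^ d := by
    induction d, hd using Nat.le_induction with
    | base => norm_num
    | succ d hd ih => rw [pow_succ]; nlinarith
  calc (2 * d + 1) ^ d * d ≤ (2 ^ d) ^ d * 2 ^ d := by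
        gcongr
        · nlinarith
        · exact Nat.lt_two_pow_self.le
    _ = 2 ^ (d * (d + 1)) := by ring
    _ ≤ 2 ^ 2 ^ d := Nat.pow_le_pow_right two_pos hexp

lemma IsKStable.eq_empty {G : Type*} [Group G] {k : ℕ} (hk : k ≤ 1) {A : Set G}
    (hA : IsKStable k A) : A = ∅ := by
  by_contra! hne
  obtain ⟨x, hx⟩ := hne
  refine hA ⟨fun _ ↦ x, fun _ ↦ 1, fun i j ↦ ?_⟩
  simp only [mul_one, hx, true_iff, Fin.le_def]
  lia

lemma exists_forall_isKStable_isAlmostHomogeneous (k : ℕ) :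
    ∃ C : ℝ, ∀ (G : Type*) [Group G] [Finite G] (A : Set G), IsKStable k A →
      ∀ ε : ℝ, 0 < ε → ε ≤ 1 → ∃ H : Subgroup G,
        (H.index : ℝ) ≤ C * ε⁻¹ ^ k ^ 2 ^ 2 ^ (2 * k) ∧
        IsAlmostHomogeneous A H (ε * Nat.card H / H.index) := by
  rcases Nat.lt_or_ge k 2 with hk | hk
  · refine ⟨1, fun G _ _ A hA ε hε hε₁ ↦ ⟨⊤, ?_, fun g ↦ .inl ?_⟩⟩
    · simpa using one_le_pow₀ ((one_le_inv₀ hε).2 hε₁)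
    · rw [hA.eq_empty (by lia)]
      simpa using mul_pos hε (Nat.cast_pos.2 (Nat.card_pos (α := G)))
  · set d := 2 ^ (2 * k)
    have hd₅ : 5 ≤ d := by
      calc 5 ≤ 2 ^ (2 * 2) := by norm_num
        _ ≤ d := Nat.pow_le_pow_right two_pos (by lia)
    have hexp : (2 * d + 1) ^ d * d ≤ k ^ 2 ^ d :=
      (two_mul_add_one_pow_mul_le_two_pow_two_pow hd₅).trans (Nat.pow_le_pow_left hk _)
    refine ⟨2 ^ d * (2 ^ (3 * d + 3)) ^ ((2 * d + 1) ^ d * d), fun G _ _ A hA ε hε hε₁ ↦ ?_⟩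
    obtain ⟨H, hindex, hH⟩ := exists_index_le_and_isAlmostHomogeneous
      (fun h ↦ hA.not_hasTree (h.of_le (Nat.sub_le d 1))) hε hε₁
    refine ⟨H, hindex.trans ?_, hH⟩
    rw [mul_pow, ← mul_assoc]
    gcongr
    exact (one_le_inv₀ hε).2 hε₁

theorem theorem1p3 (k : ℕ) :
    ∃ (C : ℝ) (e : ℕ), ∀ (G : Type*) [Group G] [Finite G] (A : Set G), IsKStable k A →
      ∀ ε : ℝ, 0 < ε → ε ≤ 1 / 2 →
        ∃ H : Subgroup G,
          (H.index : ℝ) ≤ ε⁻¹ ^ e ∧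
          (H.index : ℝ) ≤ C * ε⁻¹ ^ (k ^ (2 ^ (2 ^ (2 * k)))) ∧
          (∃ D : Set G, IsUnionOfLeftCosets H D ∧
            ((A ∆ D).ncard : ℝ) < ε * (Nat.card H : ℝ)) ∧
          (∀ g : G,
            (((g • (H : Set G)) ∩ A).ncard : ℝ) < ε * (Nat.card H : ℝ) / (H.index : ℝ) ∨
            (((g • (H : Set G)) \ A).ncard : ℝ) < ε * (Nat.card H : ℝ) / (H.index : ℝ)) := by
  obtain ⟨C, hC⟩ := exists_forall_isKStable_isAlmostHomogeneous k
  obtain ⟨j, hj⟩ := pow_unbounded_of_one_lt C one_lt_two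
  refine ⟨C, j + k ^ 2 ^ 2 ^ (2 * k), fun G _ _ A hA ε hε hε₂ ↦ ?_⟩
  obtain ⟨H, hindex, hH⟩ := hC G A hA ε hε (by linarith)
  obtain ⟨D, hD, hAD⟩ := hH.exists_isUnionOfLeftCosets
  have hCε : C ≤ ε⁻¹ ^ j := hj.le.trans <| by
    gcongr
    rw [le_inv_comm₀ two_pos hε]
    linarith
  refine ⟨H, hindex.trans ?_, hindex, ⟨D, hD, ?_⟩, hH⟩
  · rw [pow_add]
    gcongr
  · rwa [mul_div_cancel₀ _ (Nat.cast_ne_zero.2 H.index_ne_zero_of_finite)] at hAD
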